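/- Consider the unknown polynomial system $\dot x = A_\star Z(x) + B_\star W(x)u + d$ with state $x\in\mathbb R^n$, input $u\in\mathbb R^m$, disturbance $d\in\mathbb R^n$, known regressors $Z(x)\in\mathbb R^N$ and $W(x)\in\mathbb R^{M\times m}$ whose entries are polynomials (for instance, monomials) in $x$, and unknown matrices $A_\star\in\mathbb R^{n\times N}$, $B_\star\in\mathbb R^{n\times M}$. Samples $x(t_i)$, $u(t_i)$, $\dot x(t_i)$, $i=0,\dots,T-1$, satisfying $\dot x(t_i)=A_\star Z(x(t_i))+B_\star W(x(t_i))u(t_i)+d(t_i)$ are collected in $$V_0=[W(x(t_0))u(t_0)\;\cdots\;W(x(t_{T-1}))u(t_{T-1})],\quad Z_0=[Z(x(t_0))\;\cdots\;Z(x(t_{T-1}))],\quad X_1=[\dot x(t_0)\;\cdots\;\dot x(t_{T-1})],$$ and the unknown $D_0=[d(t_0)\;\cdots\;d(t_{T-1})]$ lies in $\mathcal D=\{D\in\mathbb R^{n\times T}: DD^\top\preceq\Delta\Delta^\top\}$ for a given matrix $\Delta$. Let $$\tilde{\mathcal C}=\{(A,B): X_1=AZ_0+BV_0+D \text{ for some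 } D\in\mathcal D\},$$ so that $(A_\star,B_\star)\in\tilde{\mathcal C}$. Assume that $\begin{bmatrix}Z_0\\V_0\end{bmatrix}$ has full row rank, and set $$\tilde{\mathbf A}=\begin{bmatrix}Z_0\\V_0\end{bmatrix}\begin{bmatrix}Z_0\\V_0\end{bmatrix}^\top,\quad \tilde{\mathbf B}=-\begin{bmatrix}Z_0\\V_0\end{bmatrix}X_1^\top,\quad \tilde{\mathbf C}=X_1X_1^\top-\Delta\Delta^\top,\quad \tilde Z_c=-\tilde{\mathbf A}^{-1}\tilde{\mathbf B},\quad \tilde{\mathbf Q}=\tilde{\mathbf B}^\top\tilde{\mathbf A}^{-1}\tilde{\mathbf B}-\tilde{\mathbf C}.$$ (Then $\tilde{\mathbf A}\succ0$ and $\tilde{\mathbf Q}\succeq0$; powers $1/2$ and $-1/2$ denote positive semidefinite square roots.) Let $\ell_0,\ell_1,\ell_2$ be positive definite polynomials on $\mathbb R^n$ (zero at zero and positive elsewhere) and let $c>0$. Suppose there are real polynomials $s_1,s_2,V,\lambda$ on $\mathbb R^n$ and a polynomial vector $k$ with values in $\mathbb R^m$ such that $V(0)=0$, $k(0)=0$ and,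 for every $x\in\mathbb R^n$, $s_1(x)\ge0$, $s_2(x)\ge0$, $\lambda(x)>0$, $$V(x)-\ell_1(x)+s_1(x)(\ell_0(x)-c)\ge0$$ and, with $\zeta(x)=\begin{bmatrix}Z(x)\\W(x)k(x)\end{bmatrix}$, $$\begin{bmatrix}\ell_2(x)+\frac{\partial V}{\partial x}(x)\tilde Z_c^\top\zeta(x)-s_2(x)(\ell_0(x)-c)&\star&\star\\ \tilde{\mathbf A}^{-1/2}\zeta(x)&-\lambda(x)I&\star\\ \lambda(x)\tilde{\mathbf Q}^{1/2}\frac{\partial V}{\partial x}(x)^\top&0&-4\lambda(x)I\end{bmatrix}\preceq0,$$ where $\star$ denotes the entries that make the matrix symmetric. Then, for every $(A,B)\in\tilde{\mathcal C}$, the origin is a locally asymptotically stable equilibrium of $\dot x=f_{A,B}(x):=AZ(x)+BW(x)k(x)$ (it is a Lyapunov stable equilibrium, and solutions starting close enough to it exist for all $t\ge0$ and converge to it); in particular this holds for $(A_\star,B_\star)$. -/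

import Mathlib

open scoped MatrixOrder

noncomputable section

namespace DataDriven

/-! ### Local asymptotic stability of an equilibrium at the origin -/

/-- The origin is a locally asymptotically stable equilibrium of `ẋ = f x`: it is an equilibrium;
initial states close to the origin have a solution defined for all `t ≥ 0`; the origin is Lyapunov
stable (with respect to every solution on every interval `[0, τ)`); and every solution on `[0, ∞)`
starting close enough to the origin converges to it. -/
structure IsLocallyAsymptoticallyStable {E : Type*} [NormedAddCommGroup E] [NormedSpace ℝ E]
    (f : E → E) : Prop where
  equilibrium : f 0 = 0
  exists_solution : ∃ δ : ℝ, 0 < δ ∧ ∀ x₀ : E, ‖x₀‖ < δ →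
    ∃ φ : ℝ → E, φ 0 = x₀ ∧ IsIntegralCurveOn φ (fun _ => f) (Set.Ici 0)
  stable : ∀ ε : ℝ, 0 < ε → ∃ δ : ℝ, 0 < δ ∧ ∀ (τ : ℝ) (φ : ℝ → E),
    IsIntegralCurveOn φ (fun _ => f) (Set.Ico 0 τ) → ‖φ 0‖ < δ →
      ∀ t ∈ Set.Ico 0 τ, ‖φ t‖ < ε
  attractive : ∃ δ : ℝ, 0 < δ ∧ ∀ φ : ℝ → E,
    IsIntegralCurveOn φ (fun _ => f) (Set.Ici 0) → ‖φ 0‖ < δ →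
      Filter.Tendsto φ Filter.atTop (nhds 0)

/-! ### Polynomials and polynomial vectors and matrices in the state -/

/-- A polynomial is positive definite if it is zero at zero and positive elsewhere. -/
def PolyPosDef {n : ℕ} (p : MvPolynomial (Fin n) ℝ) : Prop :=
  MvPolynomial.eval 0 p = 0 ∧ ∀ x : Fin n → ℝ, x ≠ 0 → 0 < MvPolynomial.eval x p

/-- The value at `x` of a vector of polynomials. -/
def evalVec {n : ℕ} {ι : Type*} (p : ι → MvPolynomial (Fin n) ℝ) (x : Fin n → ℝ) : ι → ℝ :=
  fun i => MvPolynomial.eval x (p i)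

/-- The value at `x` of a matrix of polynomials. -/
def evalMat {n : ℕ} {ι κ : Type*} (P : Matrix ι κ (MvPolynomial (Fin n) ℝ)) (x : Fin n → ℝ) :
    Matrix ι κ ℝ :=
  P.map (MvPolynomial.eval x)

/-- The gradient `(∂V/∂x (x))ᵀ` of a polynomial `V` at `x`. -/
def gradPoly {n : ℕ} (V : MvPolynomial (Fin n) ℝ) (x : Fin n → ℝ) : Fin n → ℝ :=
  fun i => MvPolynomial.eval x (MvPolynomial.pderiv i V)

/-! ### Data and the set of dynamics consistent with the data -/

/-- The matrix with columns `v 0, …, v (T - 1)`. -/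
def colMatrix {ι : Type*} {T : ℕ} (v : Fin T → ι → ℝ) : Matrix ι (Fin T) ℝ :=
  Matrix.of fun i j => v j i

/-- The disturbance set `{D : D Dᵀ ⪯ Δ Δᵀ}`. -/
def disturbanceSet {n r : ℕ} (T : ℕ) (Δ : Matrix (Fin n) (Fin r) ℝ) :
    Set (Matrix (Fin n) (Fin T) ℝ) :=
  {D | (Δ * Δ.transpose - D * D.transpose).PosSemidef}

/-- The set of pairs `(A, B)` consistent with the data:
`X₁ = A Z₀ + B V₀ + D` for some disturbance matrix `D` in the disturbance set. -/
def consistentSet {n N M T r : ℕ} (X₁ : Matrix (Fin n) (Fin T) ℝ) (Z₀ : Matrix (Fin N) (Fin T) ℝ)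
    (V₀ : Matrix (Fin M) (Fin T) ℝ) (Δ : Matrix (Fin n) (Fin r) ℝ) :
    Set (Matrix (Fin n) (Fin N) ℝ × Matrix (Fin n) (Fin M) ℝ) :=
  {AB | ∃ D ∈ disturbanceSet T Δ, X₁ = AB.1 * Z₀ + AB.2 * V₀ + D}

/-- `𝐀 = [Z₀; V₀] [Z₀; V₀]ᵀ`. -/
def ellA {N M T : ℕ} (Z₀ : Matrix (Fin N) (Fin T) ℝ) (V₀ : Matrix (Fin M) (Fin T) ℝ) :
    Matrix (Fin N ⊕ Fin M) (Fin N ⊕ Fin M) ℝ :=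
  Matrix.fromRows Z₀ V₀ * (Matrix.fromRows Z₀ V₀).transpose

/-- `𝐁 = -[Z₀; V₀] X₁ᵀ`. -/
def ellB {n N M T : ℕ} (X₁ : Matrix (Fin n) (Fin T) ℝ) (Z₀ : Matrix (Fin N) (Fin T) ℝ)
    (V₀ : Matrix (Fin M) (Fin T) ℝ) : Matrix (Fin N ⊕ Fin M) (Fin n) ℝ :=
  -(Matrix.fromRows Z₀ V₀ * X₁.transpose)

/-- `𝐂 = X₁ X₁ᵀ - Δ Δᵀ`. -/
def ellC {n T r : ℕ} (X₁ : Matrix (Fin n) (Fin T) ℝ) (Δ : Matrix (Fin n) (Fin r) ℝ) :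
    Matrix (Fin n) (Fin n) ℝ :=
  X₁ * X₁.transpose - Δ * Δ.transpose

/-- The center `Z_c = -𝐀⁻¹ 𝐁` of the matrix ellipsoid. -/
def ellCenter {n N M T : ℕ} (X₁ : Matrix (Fin n) (Fin T) ℝ) (Z₀ : Matrix (Fin N) (Fin T) ℝ)
    (V₀ : Matrix (Fin M) (Fin T) ℝ) : Matrix (Fin N ⊕ Fin M) (Fin n) ℝ :=
  -((ellA Z₀ V₀)⁻¹ * ellB X₁ Z₀ V₀)

/-- `𝐐 = 𝐁ᵀ 𝐀⁻¹ 𝐁 - 𝐂`. -/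
def ellQ {n N M T r : ℕ} (X₁ : Matrix (Fin n) (Fin T) ℝ) (Z₀ : Matrix (Fin N) (Fin T) ℝ)
    (V₀ : Matrix (Fin M) (Fin T) ℝ) (Δ : Matrix (Fin n) (Fin r) ℝ) : Matrix (Fin n) (Fin n) ℝ :=
  (ellB X₁ Z₀ V₀).transpose * (ellA Z₀ V₀)⁻¹ * ellB X₁ Z₀ V₀ - ellC X₁ Δ

/-! ### Closed loop and the decrease condition -/

/-- The stacked vector `[Z(x); W(x) k(x)]`. -/
def regressor {n m N M : ℕ} (Z : Fin N → MvPolynomial (Fin n) ℝ)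
    (W : Matrix (Fin M) (Fin m) (MvPolynomial (Fin n) ℝ)) (k : Fin m → MvPolynomial (Fin n) ℝ)
    (x : Fin n → ℝ) : Fin N ⊕ Fin M → ℝ :=
  Sum.elim (evalVec Z x) (Matrix.mulVec (evalMat W x) (evalVec k x))

/-- The closed-loop vector field `f_{A,B}(x) = A Z(x) + B W(x) k(x)` on Euclidean space. -/
def closedLoop {n m N M : ℕ} (Z : Fin N → MvPolynomial (Fin n) ℝ)
    (W : Matrix (Fin M) (Fin m) (MvPolynomial (Fin n) ℝ)) (k : Fin m → MvPolynomial (Fin n) ℝ)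
    (A : Matrix (Fin n) (Fin N) ℝ) (B : Matrix (Fin n) (Fin M) ℝ)
    (x : EuclideanSpace ℝ (Fin n)) : EuclideanSpace ℝ (Fin n) :=
  WithLp.toLp 2 (Matrix.mulVec A (evalVec Z x.ofLp) +
    Matrix.mulVec B (Matrix.mulVec (evalMat W x.ofLp) (evalVec k x.ofLp)))

/-- The symmetric block matrix
`[a, ⋆, ⋆; Ae^{-1/2} ζ, -l I, ⋆; l Qe^{1/2} g, 0, -4 l I]`
with `a`, `l` scalars and `ζ`, `g` column vectors. -/
def decreaseMatrix {n N M : ℕ} (Ae : Matrix (Fin N ⊕ Fin M) (Fin N ⊕ Fin M) ℝ)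
    (Qe : Matrix (Fin n) (Fin n) ℝ) (a l : ℝ) (ζ : Fin N ⊕ Fin M → ℝ) (g : Fin n → ℝ) :
    Matrix (Unit ⊕ ((Fin N ⊕ Fin M) ⊕ Fin n)) (Unit ⊕ ((Fin N ⊕ Fin M) ⊕ Fin n)) ℝ :=
  let R : Matrix ((Fin N ⊕ Fin M) ⊕ Fin n) Unit ℝ :=
    Matrix.fromRows
      (Matrix.replicateCol Unit (Matrix.mulVec (CFC.sqrt Ae⁻¹) ζ))
      (Matrix.replicateCol Unit (l • Matrix.mulVec (CFC.sqrt Qe) g))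
  Matrix.fromBlocks (Matrix.of fun _ _ => a) R.transpose R
    (Matrix.fromBlocks (-(l • 1)) 0 0 (-((4 * l) • 1)))

end DataDriven

end

/-! Write `P = [A B]`, `ζ = [Z; W k]`, and `E = Pᵀ - Z_c`. Completing the square in `D = X₁ - P [Z₀;
V₀]` gives the identity `𝐐 - Eᵀ 𝐀 E = Δ Δᵀ - D Dᵀ`, so every consistent pair satisfies `Eᵀ 𝐀 E ⪯ 𝐐`
(`ellQ_sub_posSemidef`). With `g` the gradient of `V`, the derivative of `V` along the closed loop
is `gᵀ Z_cᵀ ζ + gᵀ Eᵀ ζ`. Young's inequality bounds the unknown term by `λ⁻¹ ζᵀ 𝐀⁻¹ ζ + (λ/4) gᵀ 𝐐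
g` (`dotProduct_mulVec_transpose_le`), which is what the Schur complement of the block matrix
inequality controls (`add_le_zero_of_decreaseMatrix`).

Hence `V̇ ≤ -ℓ₂ + s₂ (ℓ₀ - c)`, while `V ≥ ℓ₁ - s₁ (ℓ₀ - c)`. Near the origin `ℓ₀ < c`, so the
multiplier terms have the favourable sign: `V` is positive and strictly decreasing away from the
origin. Lyapunov's theorem (`isLocallyAsymptoticallyStable_of_lyapunov`) concludes. -/

namespace DataDriven

/-! ### Lyapunov's theorem for local asymptotic stability. -/

section Lyapunov

open Set Metric Filter Topology

variable {E : Type*} [NormedAddCommGroup E] [NormedSpace ℝ E]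

/-- Along an integral curve on which the Lie derivative of `V` is at most `-η`, the function `V`
decreases at rate at least `η`. -/
lemma lyapunov_le_sub_mul {f : E → E} {V : E → ℝ} {V' : E → E →L[ℝ] ℝ}
    (hV : ∀ x, HasFDerivAt V (V' x) x) {φ : ℝ → E} {b η : ℝ} (hb : 0 ≤ b)
    (hφ : IsIntegralCurveOn φ (fun _ => f) (Icc 0 b))
    (hd : ∀ t ∈ Ioo 0 b, V' (φ t) (f (φ t)) ≤ -η) :
    V (φ b) ≤ V (φ 0) - η * b := by
  have hderiv : ∀ t ∈ Icc 0 b,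
      HasDerivWithinAt (fun s => V (φ s)) (V' (φ t) (f (φ t))) (Icc 0 b) t := fun t ht =>
    (hV (φ t)).comp_hasDerivWithinAt t (hφ t ht)
  have h := (convex_Icc 0 b).image_sub_le_mul_sub_of_deriv_le (f := fun s => V (φ s)) (C := -η)
    (fun t ht => (hderiv t ht).continuousWithinAt)
    (fun t ht => ((hderiv t (interior_subset ht)).differentiableWithinAt).mono interior_subset)
    (fun t ht => by
      rw [interior_Icc] at ht
      rw [((hderiv t (Ioo_subset_Icc_self ht)).hasDerivAt (Icc_mem_nhds ht.1 ht.2)).deriv]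
      exact hd t ht) 0 (left_mem_Icc.2 hb) b (right_mem_Icc.2 hb) hb
  rw [sub_zero] at h
  linarith

/-- Lyapunov stability from a positive definite function that does not increase along `f` near the
origin. -/
lemma exists_forall_norm_lt_of_lyapunov [ProperSpace E] {V : E → ℝ} {V' : E → E →L[ℝ] ℝ}
    (hV : ∀ x, HasFDerivAt V (V' x) x) (hV0 : V 0 = 0) {ε : ℝ} (hε : 0 < ε)
    (hpos : ∀ x, x ≠ 0 → ‖x‖ ≤ ε → 0 < V x) :
    ∃ δ : ℝ, 0 < δ ∧ ∀ (f : E → E), (∀ x, ‖x‖ ≤ ε → V' x (f x) ≤ 0) → ∀ (τ : ℝ) (φ : ℝ → E),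
      IsIntegralCurveOn φ (fun _ => f) (Ico 0 τ) → ‖φ 0‖ < δ → ∀ t ∈ Ico 0 τ, ‖φ t‖ < ε := by
  have hVc : Continuous V := continuous_iff_continuousAt.2 fun x => (hV x).continuousAt
  obtain ⟨m, hm, hmV⟩ := (isCompact_sphere (0 : E) ε).exists_forall_le' hVc.continuousOn
    (a := 0) (fun x hx => by
      have hx' : ‖x‖ = ε := by simpa using hx
      exact hpos x (fun h => by simp [h] at hx'; linarith) hx'.le)
  have hev : ∀ᶠ x in 𝓝 (0 : E), V x < m := hVc.continuousAt.eventually_lt_const (by rwa [hV0])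
  obtain ⟨δ, hδ, hδV⟩ := Metric.eventually_nhds_iff.1 hev
  refine ⟨min δ ε, lt_min hδ hε, fun f hf τ φ hφ h0 t ht => ?_⟩
  by_contra! hcon
  have hsub : Icc 0 t ⊆ Ico 0 τ := fun s hs => ⟨hs.1, hs.2.trans_lt ht.2⟩
  have hc : ContinuousOn (fun s => ‖φ s‖) (Icc 0 t) := (hφ.continuousOn.mono hsub).norm
  have hK : IsCompact (Icc 0 t ∩ (fun s => ‖φ s‖) ⁻¹' {ε}) :=
    isCompact_Icc.of_isClosed_subset
      (hc.preimage_isClosed_of_isClosed isClosed_Icc isClosed_singleton) inter_subset_left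
  obtain ⟨s₁, hs₁, hs₁'⟩ := intermediate_value_Icc ht.1 hc
    ⟨(h0.trans_le (min_le_right _ _)).le, hcon⟩
  -- `s₀` is the first time the curve meets the sphere of radius `ε`. Until then it stays in the
  -- ball where `V` cannot increase, so it cannot reach `V ≥ m`.
  obtain ⟨s₀, ⟨hs₀, hs₀'⟩, hmin⟩ := hK.exists_isLeast ⟨s₁, hs₁, hs₁'⟩
  have hle : ∀ s ∈ Ioo 0 s₀, ‖φ s‖ ≤ ε := by
    intro s hs
    by_contra! hs'
    have hst : s ≤ t := hs.2.le.trans hs₀.2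
    obtain ⟨s₂, hs₂, hs₂'⟩ := intermediate_value_Icc hs.1.le
      (hc.mono (Icc_subset_Icc_right hst)) ⟨(h0.trans_le (min_le_right _ _)).le, hs'.le⟩
    have := hmin ⟨⟨hs₂.1, hs₂.2.trans hst⟩, hs₂'⟩
    linarith [hs₂.2, hs.2]
  have hdec := lyapunov_le_sub_mul (η := 0) hV hs₀.1
    (hφ.mono ((Icc_subset_Icc_right hs₀.2).trans hsub))
    (fun s hs => by simpa using hf _ (hle s hs))
  have h1 : V (φ 0) < m := hδV (by simpa using h0.trans_le (min_le_left _ _))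
  have h2 : m ≤ V (φ s₀) := hmV _ (by simpa using hs₀')
  linarith

/-- A bounded, globally Lipschitz vector field has global integral curves. -/
lemma exists_isIntegralCurve_of_lipschitz_of_bounded [CompleteSpace E] {g : E → E}
    {K : NNReal} (hK : LipschitzWith K g) {C : NNReal} (hC : ∀ x, ‖g x‖ ≤ C) (x₀ : E) :
    ∃ φ : ℝ → E, φ 0 = x₀ ∧ IsIntegralCurve φ (fun _ => g) := by
  have hex : ∀ T : NNReal, ∃ φ : ℝ → E, φ 0 = x₀ ∧
      ∀ t ∈ Ioo (-T : ℝ) T, HasDerivAt φ (g (φ t)) t := by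
    intro T
    -- The speed is at most `C`, so a ball of radius `C * T` suffices for time `T`, whatever `T` is.
    have hp : IsPicardLindelof (fun _ => g) (tmin := -T) (tmax := T)
        ⟨0, by simp, by simp⟩ x₀ (C * T) 0 C K :=
      IsPicardLindelof.of_time_independent (fun x _ => hC x) hK.lipschitzOnWith (by simp)
    obtain ⟨φ, h0, hφ⟩ := hp.exists_eq_forall_mem_Icc_hasDerivWithinAt₀
    exact ⟨φ, h0, fun t ht => (hφ t (Ioo_subset_Icc_self ht)).hasDerivAt (Icc_mem_nhds ht.1 ht.2)⟩
  choose γ hγ0 hγ using hex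
  have huniq : ∀ (S T : NNReal), S ≤ T → EqOn (γ S) (γ T) (Ioo (-S : ℝ) S) := by
    intro S T hST
    rcases eq_or_lt_of_le (zero_le (a := S)) with h | h
    · simp [← h]
    have hST' : (S : ℝ) ≤ T := by exact_mod_cast hST
    have hS : (0 : ℝ) < S := by exact_mod_cast h
    refine ODE_solution_unique_of_mem_Ioo (v := fun _ => g) (s := fun _ => univ) (K := K) (t₀ := 0)
      (fun t _ => hK.lipschitzOnWith) ⟨by linarith, hS⟩
      (fun t ht => ⟨hγ S t ht, mem_univ _⟩)
      (fun t ht => ⟨hγ T t ⟨by linarith [ht.1], by linarith [ht.2]⟩, mem_univ _⟩)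
      (by rw [hγ0, hγ0])
  -- By uniqueness the local solutions agree on overlaps. Near a fixed `t`, the glued curve equals
  -- the single solution of index `‖t‖₊ + 2`.
  refine ⟨fun t => γ (‖t‖₊ + 1) t, hγ0 _, fun t => ?_⟩
  have hval : ∀ s : ℝ, |s| < |t| + 1 → γ (‖s‖₊ + 1) s = γ (‖t‖₊ + 2) s := by
    intro s hs
    refine huniq _ _ ?_ ?_
    · rw [← NNReal.coe_le_coe]
      push_cast
      simp only [Real.norm_eq_abs]
      linarith
    · have : |s| < ((‖s‖₊ + 1 : NNReal) : ℝ) := by simp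
      exact abs_lt.1 this
  have hmem : |t| < ((‖t‖₊ + 2 : NNReal) : ℝ) := by simp
  have hd := hγ (‖t‖₊ + 2) t (abs_lt.1 hmem)
  rw [← hval t (by simp)] at hd
  refine hd.congr_of_eventuallyEq ?_
  filter_upwards [(continuous_abs.tendsto t).eventually_lt_const (lt_add_one |t|)] with s hs
    using hval s hs

/-- **Lyapunov's theorem** on local asymptotic stability. -/
theorem isLocallyAsymptoticallyStable_of_lyapunov [FiniteDimensional ℝ E] {f : E → E}
    (hf : ContDiff ℝ 1 f) (hf0 : f 0 = 0) {V : E → ℝ} {V' : E → E →L[ℝ] ℝ}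
    (hV : ∀ x, HasFDerivAt V (V' x) x) (hV' : Continuous V') (hV0 : V 0 = 0)
    {r : ℝ} (hr : 0 < r) (hpos : ∀ x, x ≠ 0 → ‖x‖ ≤ r → 0 < V x)
    (hdec : ∀ x, x ≠ 0 → ‖x‖ ≤ r → V' x (f x) < 0) :
    IsLocallyAsymptoticallyStable f := by
  have : ProperSpace E := FiniteDimensional.proper_real E
  have hdec' : ∀ x, ‖x‖ ≤ r → V' x (f x) ≤ 0 := by
    intro x hx
    rcases eq_or_ne x 0 with rfl | h
    · simp [hf0]
    · exact (hdec x h hx).le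
  have hstab : ∀ ε : ℝ, 0 < ε → ∃ δ : ℝ, 0 < δ ∧ ∀ (τ : ℝ) (φ : ℝ → E),
      IsIntegralCurveOn φ (fun _ => f) (Ico 0 τ) → ‖φ 0‖ < δ → ∀ t ∈ Ico 0 τ, ‖φ t‖ < ε := by
    intro ε hε
    obtain ⟨δ, hδ, h⟩ := exists_forall_norm_lt_of_lyapunov hV hV0 (lt_min hε hr)
      (fun x hx hxr => hpos x hx (hxr.trans (min_le_right _ _)))
    exact ⟨δ, hδ, fun τ φ hφ h0 t ht => (h f (fun x hx => hdec' x (hx.trans (min_le_right _ _)))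
      τ φ hφ h0 t ht).trans_le (min_le_left _ _)⟩
  refine ⟨hf0, ?_, hstab, ?_⟩
  · obtain ⟨δ, hδ, h⟩ := exists_forall_norm_lt_of_lyapunov hV hV0 hr hpos
    refine ⟨δ, hδ, fun x₀ hx₀ => ?_⟩
    -- The field is cut off outside the ball of radius `r` to obtain global solutions. Since `δ`
    -- does not depend on the field, stability applies to the cut-off field and keeps the solution
    -- where it coincides with `f`.
    let χ : ContDiffBump (0 : E) := ⟨r, r + 1, hr, lt_add_one r⟩
    have hg : ContDiff ℝ 1 (fun x => χ x • f x) := χ.contDiff.smul hf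
    have hgs : HasCompactSupport (fun x => χ x • f x) := χ.hasCompactSupport.smul_right
    have hgeq : ∀ x, ‖x‖ ≤ r → χ x • f x = f x := fun x hx => by
      rw [χ.one_of_mem_closedBall (by simpa using hx), one_smul]
    obtain ⟨K, hK⟩ := hg.lipschitzWith_of_hasCompactSupport hgs one_ne_zero
    obtain ⟨C, hC⟩ := hgs.exists_bound_of_continuous hg.continuous
    obtain ⟨φ, h0, hφ⟩ := exists_isIntegralCurve_of_lipschitz_of_bounded hK (C := C.toNNReal)
      (fun x => (hC x).trans (Real.le_coe_toNNReal C)) x₀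
    refine ⟨φ, h0, fun t ht => ?_⟩
    have hlt := h (fun x => χ x • f x) (fun x hx => by rw [hgeq x hx]; exact hdec' x hx) (t + 1) φ
      (hφ.isIntegralCurveOn _) (by rwa [h0]) t ⟨ht, lt_add_one t⟩
    have := hφ t
    simp only [hgeq _ hlt.le] at this
    exact this.hasDerivWithinAt
  · obtain ⟨δ, hδ, h⟩ := hstab r hr
    refine ⟨δ, hδ, fun φ hφ h0 => ?_⟩
    have hmem : ∀ t, 0 ≤ t → ‖φ t‖ < r := fun t ht =>
      h (t + 1) φ (hφ.mono Ico_subset_Ici_self) h0 t ⟨ht, lt_add_one t⟩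
    refine Metric.tendsto_atTop.2 fun ε hε => ?_
    obtain ⟨ρ, hρ, hρφ⟩ := hstab ε hε
    -- By stability, entering the ball of radius `ρ` once is enough. Otherwise `V` decreases at a
    -- uniform rate `η` on the annulus `ρ ≤ ‖x‖ ≤ r`, and is at most `-1` at time `(V (φ 0) + 1) /
    -- η`.
    obtain ⟨t₀, ht₀, hφt₀⟩ : ∃ t₀, 0 ≤ t₀ ∧ ‖φ t₀‖ < ρ := by
      by_contra! hfar
      have hcomp : IsCompact (closedBall (0 : E) r ∩ {x | ρ ≤ ‖x‖}) :=
        (isCompact_closedBall _ _).inter_right (isClosed_le continuous_const continuous_norm)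
      have hcont : Continuous fun x => -V' x (f x) := (hV'.clm_apply hf.continuous).neg
      obtain ⟨η, hη, hηV⟩ := hcomp.exists_forall_le' hcont.continuousOn (a := 0) (fun x hx => by
        have hx' : ‖x‖ ≤ r := by simpa using hx.1
        have hx2 : ρ ≤ ‖x‖ := hx.2
        have := hdec x (norm_pos_iff.1 (hρ.trans_le hx2)) hx'
        linarith)
      have hV00 : 0 ≤ V (φ 0) := by
        rcases eq_or_ne (φ 0) 0 with h | h
        · rw [h, hV0]
        · exact (hpos _ h (hmem 0 le_rfl).le).le
      have hb : 0 ≤ (V (φ 0) + 1) / η := by positivity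
      have hle := lyapunov_le_sub_mul (η := η) hV hb (hφ.mono Icc_subset_Ici_self)
        (fun t ht => by
          have := hηV (φ t) ⟨by simpa using (hmem t ht.1.le).le, hfar t ht.1.le⟩
          linarith)
      have hVp := hpos (φ ((V (φ 0) + 1) / η)) (norm_pos_iff.1 (hρ.trans_le (hfar _ hb)))
        (hmem _ hb).le
      rw [mul_div_cancel₀ _ hη.ne'] at hle
      linarith
    refine ⟨t₀, fun t ht => ?_⟩
    have hshift : IsIntegralCurveOn (φ ∘ (· + t₀)) (fun _ => f) (Ico 0 (t - t₀ + 1)) := by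
      refine (hφ.comp_add t₀).mono fun s hs => ?_
      rw [mem_vadd_set_iff_neg_vadd_mem]
      simpa using add_nonneg ht₀ hs.1
    have := hρφ _ _ hshift (by simpa using hφt₀) (t - t₀) ⟨by linarith, by linarith⟩
    simpa using this

end Lyapunov

/-! ### Smoothness and derivatives of polynomial functions. -/

section Polynomial

variable {n : ℕ}

lemma hasFDerivAt_eval (p : MvPolynomial (Fin n) ℝ) (x : Fin n → ℝ) :
    HasFDerivAt (fun y => MvPolynomial.eval y p)
      (∑ i, gradPoly p x i • ContinuousLinearMap.proj (R := ℝ) (φ := fun _ : Fin n => ℝ) i) x := by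
  induction p using MvPolynomial.induction_on with
  | C a => simpa [gradPoly] using hasFDerivAt_const a x
  | add p q hp hq =>
    simp only [map_add]
    refine (hp.add hq).congr_fderiv ?_
    simp [gradPoly, add_smul, Finset.sum_add_distrib]
  | mul_X p j hp =>
    have hj : HasFDerivAt (fun y : Fin n → ℝ => y j)
        (ContinuousLinearMap.proj (R := ℝ) (φ := fun _ : Fin n => ℝ) j) x := hasFDerivAt_apply j x
    have h := hp.mul hj
    simp only [map_mul, MvPolynomial.eval_X]
    refine h.congr_fderiv ?_
    ext v
    simp only [gradPoly, MvPolynomial.pderiv_mul, MvPolynomial.pderiv_X, map_add, map_mul,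
      MvPolynomial.eval_X, _root_.add_apply, _root_.smul_apply,
      _root_.sum_apply, ContinuousLinearMap.proj_apply, smul_eq_mul, add_mul,
      Finset.sum_add_distrib, Finset.mul_sum]
    rw [add_comm]
    congr 1
    · exact Finset.sum_congr rfl fun i _ => by ring
    · rw [Finset.sum_eq_single j]
      · simp
      · intro i _ hij
        simp [hij.symm]
      · simp

lemma contDiff_eval (p : MvPolynomial (Fin n) ℝ) {k : WithTop ℕ∞} :
    ContDiff ℝ k fun y : Fin n → ℝ => MvPolynomial.eval y p :=
  (AnalyticOnNhd.eval_mvPolynomial p).contDiff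

end Polynomial

/-! ### Completion of squares and the Schur complement. -/

section Schur

open Matrix

variable {ι κ : Type*} [Fintype ι] [Fintype κ]

/-- Completion of squares: if `Eᵀ A E ⪯ Q`, then the cross term `gᵀ Eᵀ ζ` is dominated by the
quadratic forms of `A⁻¹` at `ζ` and of `Q` at `g`. -/
lemma dotProduct_mulVec_transpose_le [DecidableEq ι] {A : Matrix ι ι ℝ} (hA : A.PosDef)
    {Q : Matrix κ κ ℝ} {E : Matrix ι κ ℝ} (hE : (Q - Eᵀ * A * E).PosSemidef) {l : ℝ} (hl : 0 < l)
    (ζ : ι → ℝ) (g : κ → ℝ) :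
    g ⬝ᵥ (Eᵀ *ᵥ ζ) ≤ l⁻¹ * (ζ ⬝ᵥ (A⁻¹ *ᵥ ζ)) + l / 4 * (g ⬝ᵥ (Q *ᵥ g)) := by
  have hsymm : Aᵀ = A := by simpa using hA.isHermitian.eq
  have hinv : A *ᵥ (A⁻¹ *ᵥ ζ) = ζ := by
    rw [mulVec_mulVec, mul_nonsing_inv _ ((isUnit_iff_isUnit_det A).1 hA.isUnit), one_mulVec]
  -- The `A`-square of this vector is `(l²/4) gᵀEᵀAEg - l gᵀEᵀζ + ζᵀA⁻¹ζ`; dividing by `l` gives the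
  -- weights in the claim.
  have h1 := hA.posSemidef.dotProduct_mulVec_nonneg ((l / 2) • (E *ᵥ g) - A⁻¹ *ᵥ ζ)
  have h2 := hE.dotProduct_mulVec_nonneg g
  have hEg : (E *ᵥ g) ⬝ᵥ (A *ᵥ (E *ᵥ g)) = g ⬝ᵥ ((Eᵀ * A * E) *ᵥ g) := by
    rw [← mulVec_mulVec, ← mulVec_mulVec, dotProduct_mulVec g, vecMul_transpose]
  have hcross : (A⁻¹ *ᵥ ζ) ⬝ᵥ (A *ᵥ (E *ᵥ g)) = g ⬝ᵥ (Eᵀ *ᵥ ζ) := by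
    rw [dotProduct_mulVec, ← mulVec_transpose, hsymm, hinv, dotProduct_mulVec g, vecMul_transpose,
      dotProduct_comm]
  have hcross' : (E *ᵥ g) ⬝ᵥ ζ = g ⬝ᵥ (Eᵀ *ᵥ ζ) := by
    rw [dotProduct_mulVec g, vecMul_transpose]
  simp only [star_trivial, mulVec_sub, mulVec_smul, hinv, sub_dotProduct, dotProduct_sub,
    smul_dotProduct, dotProduct_smul, smul_eq_mul, hcross, hcross', hEg, sub_mulVec] at h1 h2
  rw [dotProduct_comm (A⁻¹ *ᵥ ζ) ζ] at h1
  have h3 : l * (g ⬝ᵥ (Eᵀ *ᵥ ζ)) ≤ ζ ⬝ᵥ (A⁻¹ *ᵥ ζ) + l * (l / 4 * (g ⬝ᵥ (Q *ᵥ g))) := by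
    nlinarith [mul_nonneg (sq_nonneg l) h2]
  rw [← mul_le_mul_iff_right₀ hl, mul_add, mul_inv_cancel_left₀ hl.ne']
  exact h3

lemma dotProduct_sqrt_mulVec_self [DecidableEq ι] {A : Matrix ι ι ℝ} (hA : A.PosSemidef)
    (v : ι → ℝ) : (CFC.sqrt A *ᵥ v) ⬝ᵥ (CFC.sqrt A *ᵥ v) = v ⬝ᵥ (A *ᵥ v) := by
  have hs : (CFC.sqrt A)ᵀ = CFC.sqrt A := by
    simpa using (nonneg_iff_posSemidef.1 (CFC.sqrt_nonneg A)).isHermitian.eq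
  conv_rhs => rw [← CFC.sqrt_mul_sqrt_self A (nonneg_iff_posSemidef.2 hA)]
  rw [← mulVec_mulVec, dotProduct_mulVec v, ← mulVec_transpose, hs]

/-- Schur complement of the negative definite block of `decreaseMatrix`. -/
lemma add_le_zero_of_decreaseMatrix {n N M : ℕ} {Ae : Matrix (Fin N ⊕ Fin M) (Fin N ⊕ Fin M) ℝ}
    (hA : Ae.PosDef) {Qe : Matrix (Fin n) (Fin n) ℝ} (hQ : Qe.PosSemidef) {a l : ℝ} (hl : 0 < l)
    {ζ : Fin N ⊕ Fin M → ℝ} {g : Fin n → ℝ}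
    (h : (-decreaseMatrix Ae Qe a l ζ g).PosSemidef) :
    a + (l⁻¹ * (ζ ⬝ᵥ (Ae⁻¹ *ᵥ ζ)) + l / 4 * (g ⬝ᵥ (Qe *ᵥ g))) ≤ 0 := by
  have hz := dotProduct_sqrt_mulVec_self hA.inv.posSemidef ζ
  have hg := dotProduct_sqrt_mulVec_self hQ g
  simp only [decreaseMatrix] at h
  generalize CFC.sqrt Ae⁻¹ *ᵥ ζ = p at *
  generalize CFC.sqrt Qe *ᵥ g = q at *
  -- With first entry `1`, the components `l⁻¹ p` and `q / 4` maximize the quadratic form of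
  -- `decreaseMatrix`; its value there is the Schur complement.
  have h1 := h.dotProduct_mulVec_nonneg (Sum.elim (fun _ => 1)
    (Sum.elim (l⁻¹ • p) ((1 / 4 : ℝ) • q)))
  have hcol : ∀ {α : Type} (v : α → ℝ), replicateCol Unit v *ᵥ (fun _ => (1 : ℝ)) = v := by
    intro α v
    ext i
    simp [mulVec, dotProduct]
  have hrow : (fromRows (replicateCol Unit p) (replicateCol Unit (l • q)))ᵀ *ᵥ
      Sum.elim (l⁻¹ • p) ((1 / 4 : ℝ) • q) = fun _ => l⁻¹ * (p ⬝ᵥ p) + l * (1 / 4) * (q ⬝ᵥ q) := by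
    ext i
    simp only [mulVec, dotProduct]
    rw [Fintype.sum_sum_type, Finset.mul_sum, Finset.mul_sum]
    refine congrArg₂ _ (Finset.sum_congr rfl fun j _ => ?_)
      (Finset.sum_congr rfl fun j _ => ?_) <;>
      simp only [transpose_apply, fromRows_apply_inl, fromRows_apply_inr, replicateCol_apply,
        Pi.smul_apply, smul_eq_mul, Sum.elim_inl, Sum.elim_inr] <;> ring
  have ha : (of fun (_ _ : Unit) => a) *ᵥ (fun _ => (1 : ℝ)) = fun _ => a := by
    ext i
    simp [mulVec, dotProduct]
  have hd : fromBlocks (-(l • 1)) 0 0 (-((4 * l) • 1)) *ᵥ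
      Sum.elim (l⁻¹ • p) ((1 / 4 : ℝ) • q) = Sum.elim (-p) (-(l • q)) := by
    have h4 : 4 * l * (1 / 4) = l := by ring
    simp only [fromBlocks_mulVec, Sum.elim_comp_inl, Sum.elim_comp_inr, neg_mulVec, smul_mulVec,
      one_mulVec, zero_mulVec, add_zero, zero_add, smul_smul, mul_inv_cancel₀ hl.ne', one_smul, h4]
  simp only [star_trivial, neg_mulVec, fromBlocks_mulVec, Sum.elim_comp_inl, Sum.elim_comp_inr,
    hrow, ha, hd, fromRows_mulVec, hcol] at h1
  simp only [dotProduct_neg, sumElim_dotProduct_sumElim, dotProduct_add, dotProduct_smul,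
    smul_dotProduct, smul_eq_mul] at h1
  simp only [dotProduct, Finset.univ_unique, one_mul, Finset.sum_singleton] at h1 hz hg ⊢
  rw [← hz, ← hg]
  linarith

end Schur

/-! ### The matrix ellipsoid of dynamics consistent with the data. -/

section Data

open Matrix

variable {n N M T r : ℕ}

lemma ellA_posDef {Z₀ : Matrix (Fin N) (Fin T) ℝ} {V₀ : Matrix (Fin M) (Fin T) ℝ}
    (hrank : (fromRows Z₀ V₀).rank = N + M) : (ellA Z₀ V₀).PosDef := by
  have hps : (ellA Z₀ V₀).PosSemidef := by
    simpa [ellA] using posSemidef_self_mul_conjTranspose (fromRows Z₀ V₀)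
  refine hps.posDef_iff_isUnit.2 (mulVec_surjective_iff_isUnit.1 ?_)
  have hr : (ellA Z₀ V₀).rank = N + M := by rw [ellA, rank_self_mul_transpose, hrank]
  have htop : LinearMap.range (ellA Z₀ V₀).mulVecLin = ⊤ :=
    Submodule.eq_top_of_finrank_eq (by rw [← Matrix.rank, hr]; simp)
  exact LinearMap.range_eq_top.1 htop

lemma ellA_transpose (Z₀ : Matrix (Fin N) (Fin T) ℝ) (V₀ : Matrix (Fin M) (Fin T) ℝ) :
    (ellA Z₀ V₀)ᵀ = ellA Z₀ V₀ := by
  rw [ellA, transpose_mul, transpose_transpose]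

/-- Consistent dynamics lie in the matrix ellipsoid with center `ellCenter`. -/
lemma ellQ_sub_posSemidef {X₁ : Matrix (Fin n) (Fin T) ℝ} {Z₀ : Matrix (Fin N) (Fin T) ℝ}
    {V₀ : Matrix (Fin M) (Fin T) ℝ} {Δ : Matrix (Fin n) (Fin r) ℝ} (hA : (ellA Z₀ V₀).PosDef)
    {AB : Matrix (Fin n) (Fin N) ℝ × Matrix (Fin n) (Fin M) ℝ}
    (hAB : AB ∈ consistentSet X₁ Z₀ V₀ Δ) :
    (ellQ X₁ Z₀ V₀ Δ - ((fromCols AB.1 AB.2)ᵀ - ellCenter X₁ Z₀ V₀)ᵀ * ellA Z₀ V₀ *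
      ((fromCols AB.1 AB.2)ᵀ - ellCenter X₁ Z₀ V₀)).PosSemidef := by
  obtain ⟨D, hD, hX⟩ := hAB
  have hdet : IsUnit (ellA Z₀ V₀).det := (isUnit_iff_isUnit_det _).1 hA.isUnit
  have hinvT : ((ellA Z₀ V₀)⁻¹)ᵀ = (ellA Z₀ V₀)⁻¹ := by
    rw [transpose_nonsing_inv, ellA_transpose]
  have hX' : D = X₁ - fromCols AB.1 AB.2 * fromRows Z₀ V₀ := by
    rw [fromCols_mul_fromRows, hX]; abel
  have hD' : (Δ * Δᵀ - D * Dᵀ).PosSemidef := hD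
  -- The two matrices are equal: expanding `Eᵀ 𝐀 E` around the center, the terms `𝐁ᵀ 𝐀⁻¹ 𝐁` cancel.
  convert hD' using 1
  rw [hX', ellQ, ellC, ellCenter]
  generalize fromCols AB.1 AB.2 = P
  have e1 : (ellA Z₀ V₀) * ((ellA Z₀ V₀)⁻¹ * ellB X₁ Z₀ V₀) = ellB X₁ Z₀ V₀ :=
    mul_nonsing_inv_cancel_left _ _ hdet
  have e2 : ∀ Y : Matrix (Fin N ⊕ Fin M) (Fin n) ℝ,
      (ellA Z₀ V₀)⁻¹ * (ellA Z₀ V₀ * Y) = Y := fun Y => nonsing_inv_mul_cancel_left _ _ hdet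
  simp only [sub_neg_eq_add, transpose_add, transpose_transpose, transpose_mul, hinvT, Matrix.add_mul,
    Matrix.mul_add, e2, Matrix.mul_assoc, e1]
  simp only [ellA, ellB, transpose_neg, transpose_mul, transpose_transpose, transpose_sub,
    Matrix.sub_mul, Matrix.mul_sub, Matrix.neg_mul, Matrix.mul_neg, Matrix.mul_assoc]
  abel

/-- `𝐐` dominates `Eᵀ 𝐀 E ⪰ 0` as soon as one consistent pair exists. This makes `CFC.sqrt` of `𝐐` a
genuine square root. -/
lemma ellQ_posSemidef {X₁ : Matrix (Fin n) (Fin T) ℝ} {Z₀ : Matrix (Fin N) (Fin T) ℝ}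
    {V₀ : Matrix (Fin M) (Fin T) ℝ} {Δ : Matrix (Fin n) (Fin r) ℝ} (hA : (ellA Z₀ V₀).PosDef)
    {AB : Matrix (Fin n) (Fin N) ℝ × Matrix (Fin n) (Fin M) ℝ}
    (hAB : AB ∈ consistentSet X₁ Z₀ V₀ Δ) : (ellQ X₁ Z₀ V₀ Δ).PosSemidef := by
  have h := (ellQ_sub_posSemidef hA hAB).add (hA.posSemidef.conjTranspose_mul_mul_same
    ((fromCols AB.1 AB.2)ᵀ - ellCenter X₁ Z₀ V₀))
  simpa [conjTranspose_eq_transpose_of_trivial] using h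

lemma mem_consistentSet_of_data {m : ℕ} {Z : Fin N → MvPolynomial (Fin n) ℝ}
    {W : Matrix (Fin M) (Fin m) (MvPolynomial (Fin n) ℝ)}
    {A : Matrix (Fin n) (Fin N) ℝ} {B : Matrix (Fin n) (Fin M) ℝ} {Δ : Matrix (Fin n) (Fin r) ℝ}
    {x xdot d : Fin T → Fin n → ℝ} {u : Fin T → Fin m → ℝ}
    (hdata : ∀ i, xdot i = A *ᵥ evalVec Z (x i) + B *ᵥ (evalMat W (x i) *ᵥ u i) + d i)
    (hdist : colMatrix d ∈ disturbanceSet T Δ) :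
    (A, B) ∈ consistentSet (colMatrix xdot) (colMatrix fun i => evalVec Z (x i))
      (colMatrix fun i => evalMat W (x i) *ᵥ u i) Δ := by
  refine ⟨colMatrix d, hdist, ?_⟩
  ext i j
  have := congrFun (hdata j) i
  simpa [colMatrix, mul_apply, mulVec, dotProduct, -mulVec_mulVec] using this

end Data

/-! ### Closed-loop vector field and its Lyapunov function. -/

section ClosedLoop

open Matrix Filter Topology

variable {n m N M T r : ℕ} {Z : Fin N → MvPolynomial (Fin n) ℝ}
  {W : Matrix (Fin M) (Fin m) (MvPolynomial (Fin n) ℝ)} {k : Fin m → MvPolynomial (Fin n) ℝ}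

lemma ofLp_closedLoop (A : Matrix (Fin n) (Fin N) ℝ) (B : Matrix (Fin n) (Fin M) ℝ)
    (x : EuclideanSpace ℝ (Fin n)) :
    (closedLoop Z W k A B x).ofLp = fromCols A B *ᵥ regressor Z W k x.ofLp := by
  rw [regressor, fromCols_mulVec_sumElim, closedLoop]

lemma contDiff_closedLoop (A : Matrix (Fin n) (Fin N) ℝ) (B : Matrix (Fin n) (Fin M) ℝ) :
    ContDiff ℝ 1 (closedLoop Z W k A B) := by
  have he : ∀ p : MvPolynomial (Fin n) ℝ, ContDiff ℝ 1 fun x : EuclideanSpace ℝ (Fin n) =>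
      MvPolynomial.eval x.ofLp p := fun p => (contDiff_eval p).comp (PiLp.contDiff_ofLp)
  rw [contDiff_euclidean]
  intro i
  simp only [closedLoop, Pi.add_apply, mulVec, dotProduct, evalVec, evalMat, map_apply]
  exact (ContDiff.sum fun j _ => contDiff_const.mul (he _)).add
    (ContDiff.sum fun j _ => contDiff_const.mul (ContDiff.sum fun l _ => (he _).mul (he _)))

/-- The derivative of a polynomial, as a continuous linear form on Euclidean space. -/
noncomputable def evalDeriv (V : MvPolynomial (Fin n) ℝ) (x : EuclideanSpace ℝ (Fin n)) :
    EuclideanSpace ℝ (Fin n) →L[ℝ] ℝ :=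
  ∑ i, gradPoly V x.ofLp i • EuclideanSpace.proj i

lemma evalDeriv_apply (V : MvPolynomial (Fin n) ℝ) (x v : EuclideanSpace ℝ (Fin n)) :
    evalDeriv V x v = gradPoly V x.ofLp ⬝ᵥ v.ofLp := by
  simp [evalDeriv, dotProduct, _root_.sum_apply]

lemma hasFDerivAt_eval_ofLp (V : MvPolynomial (Fin n) ℝ) (x : EuclideanSpace ℝ (Fin n)) :
    HasFDerivAt (fun y : EuclideanSpace ℝ (Fin n) => MvPolynomial.eval y.ofLp V)
      (evalDeriv V x) x := by
  refine ((hasFDerivAt_eval V x.ofLp).comp x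
    (EuclideanSpace.equiv (Fin n) ℝ).hasFDerivAt).congr_fderiv ?_
  ext v
  simp [evalDeriv_apply, dotProduct, _root_.sum_apply]

lemma continuous_evalDeriv (V : MvPolynomial (Fin n) ℝ) : Continuous (evalDeriv V) := by
  have hg : ∀ i, Continuous fun x : EuclideanSpace ℝ (Fin n) => gradPoly V x.ofLp i := fun i =>
    ((contDiff_eval (k := 0) _).continuous).comp (PiLp.continuous_ofLp 2 _)
  exact continuous_finsetSum _ fun i _ => (hg i).smul continuous_const

/-- The Lyapunov decrease condition along every dynamics consistent with the data. -/
lemma eval_add_gradPoly_dotProduct_le {X₁ : Matrix (Fin n) (Fin T) ℝ}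
    {Z₀ : Matrix (Fin N) (Fin T) ℝ} {V₀ : Matrix (Fin M) (Fin T) ℝ} {Δ : Matrix (Fin n) (Fin r) ℝ}
    (hA : (ellA Z₀ V₀).PosDef) {AB : Matrix (Fin n) (Fin N) ℝ × Matrix (Fin n) (Fin M) ℝ}
    (hAB : AB ∈ consistentSet X₁ Z₀ V₀ Δ) {p q l : ℝ} (hl : 0 < l) {ζ : Fin N ⊕ Fin M → ℝ}
    {g : Fin n → ℝ}
    (h : (-decreaseMatrix (ellA Z₀ V₀) (ellQ X₁ Z₀ V₀ Δ)
      (p + g ⬝ᵥ ((ellCenter X₁ Z₀ V₀)ᵀ *ᵥ ζ) - q) l ζ g).PosSemidef) :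
    p + g ⬝ᵥ (fromCols AB.1 AB.2 *ᵥ ζ) ≤ q := by
  have h1 := add_le_zero_of_decreaseMatrix hA (ellQ_posSemidef hA hAB) hl h
  have h2 := dotProduct_mulVec_transpose_le hA (ellQ_sub_posSemidef hA hAB) hl ζ g
  rw [transpose_sub, transpose_transpose, sub_mulVec, dotProduct_sub] at h2
  linarith

theorem isLocallyAsymptoticallyStable_closedLoop {X₁ : Matrix (Fin n) (Fin T) ℝ}
    {Z₀ : Matrix (Fin N) (Fin T) ℝ} {V₀ : Matrix (Fin M) (Fin T) ℝ} {Δ : Matrix (Fin n) (Fin r) ℝ}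
    (hA : (ellA Z₀ V₀).PosDef) {AB : Matrix (Fin n) (Fin N) ℝ × Matrix (Fin n) (Fin M) ℝ}
    (hAB : AB ∈ consistentSet X₁ Z₀ V₀ Δ) {ℓ₀ ℓ₁ ℓ₂ s₁ s₂ V lam : MvPolynomial (Fin n) ℝ}
    (hℓ₀ : PolyPosDef ℓ₀) (hℓ₁ : PolyPosDef ℓ₁) (hℓ₂ : PolyPosDef ℓ₂) {c : ℝ} (hc : 0 < c)
    (hV0 : MvPolynomial.eval 0 V = 0)
    (hs : ∀ y : Fin n → ℝ, 0 ≤ MvPolynomial.eval y s₁ ∧ 0 ≤ MvPolynomial.eval y s₂)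
    (hVpos : ∀ y : Fin n → ℝ, 0 ≤ MvPolynomial.eval y V - MvPolynomial.eval y ℓ₁ +
      MvPolynomial.eval y s₁ * (MvPolynomial.eval y ℓ₀ - c))
    (hdecr : ∀ y : Fin n → ℝ, (-decreaseMatrix (ellA Z₀ V₀) (ellQ X₁ Z₀ V₀ Δ)
      (MvPolynomial.eval y ℓ₂ +
        gradPoly V y ⬝ᵥ ((ellCenter X₁ Z₀ V₀)ᵀ *ᵥ regressor Z W k y) -
        MvPolynomial.eval y s₂ * (MvPolynomial.eval y ℓ₀ - c))
      (MvPolynomial.eval y lam) (regressor Z W k y) (gradPoly V y)).PosSemidef)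
    (hlam : ∀ y : Fin n → ℝ, 0 < MvPolynomial.eval y lam) :
    IsLocallyAsymptoticallyStable (closedLoop Z W k AB.1 AB.2) := by
  have hlt : ∀ᶠ x in 𝓝 (0 : EuclideanSpace ℝ (Fin n)), MvPolynomial.eval x.ofLp ℓ₀ < c :=
    (hasFDerivAt_eval_ofLp ℓ₀ 0).continuousAt.eventually_lt_const (hℓ₀.1.trans_lt hc)
  obtain ⟨R, hR, hRc⟩ := Metric.eventually_nhds_iff.1 hlt
  have hpos : ∀ x : EuclideanSpace ℝ (Fin n), x ≠ 0 → MvPolynomial.eval x.ofLp ℓ₀ < c →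
      0 < MvPolynomial.eval x.ofLp V := by
    intro x hx hxc
    have h1 := hℓ₁.2 x.ofLp (by simpa using hx)
    nlinarith [hVpos x.ofLp, (hs x.ofLp).1]
  -- `V` vanishes at the origin and is positive nearby, so the origin is a critical point.
  have hgrad : gradPoly V 0 = 0 := by
    have hmin : IsLocalMin (fun x : EuclideanSpace ℝ (Fin n) => MvPolynomial.eval x.ofLp V) 0 := by
      filter_upwards [hlt] with x hx
      rcases eq_or_ne x 0 with rfl | h
      · exact le_rfl
      · rw [WithLp.ofLp_zero, hV0]
        exact (hpos x h hx).le
    have h0 := hmin.hasFDerivAt_eq_zero (hasFDerivAt_eval_ofLp V 0)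
    have h1 := evalDeriv_apply V 0 (WithLp.toLp 2 (gradPoly V 0))
    rw [h0] at h1
    exact dotProduct_self_eq_zero.1 (by simpa using h1.symm)
  -- The equilibrium property is deduced rather than assumed: at the origin the Schur complement
  -- reads `s₂(0) c + λ(0)⁻¹ ζᵀ 𝐀⁻¹ ζ ≤ 0`, which forces `ζ = 0` and so works for every pair at
  -- once.
  have hreg : regressor Z W k 0 = 0 := by
    have h := add_le_zero_of_decreaseMatrix hA (ellQ_posSemidef hA hAB) (hlam 0) (hdecr 0)
    simp only [hgrad, hℓ₂.1, hℓ₀.1, zero_dotProduct, mul_zero, add_zero, zero_sub,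
      mul_neg, neg_neg] at h
    by_contra hne
    have h1 := hA.inv.dotProduct_mulVec_pos hne
    rw [star_trivial] at h1
    nlinarith [mul_pos (inv_pos.2 (hlam 0)) h1, mul_nonneg (hs 0).2 hc.le]
  have hball : ∀ x : EuclideanSpace ℝ (Fin n), ‖x‖ ≤ R / 2 → MvPolynomial.eval x.ofLp ℓ₀ < c :=
    fun x hx => hRc (by rw [dist_zero_right]; linarith)
  refine isLocallyAsymptoticallyStable_of_lyapunov (contDiff_closedLoop _ _) ?_
    (hasFDerivAt_eval_ofLp V) (continuous_evalDeriv V) hV0 (half_pos hR)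
    (fun x hx hxR => hpos x hx (hball x hxR)) (fun x hx hxR => ?_)
  · apply (WithLp.ofLp_injective 2)
    rw [ofLp_closedLoop, WithLp.ofLp_zero, hreg, mulVec_zero]
  · rw [evalDeriv_apply, ofLp_closedLoop]
    have h1 := eval_add_gradPoly_dotProduct_le hA hAB (hlam x.ofLp) (hdecr x.ofLp)
    have h2 := hℓ₂.2 x.ofLp (by simpa using hx)
    nlinarith [mul_nonneg (hs x.ofLp).2 (sub_nonneg.2 (hball x hxR).le)]

end ClosedLoop

end DataDriven

theorem corollary3
    {n m N M T r : ℕ}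
    -- known regressors, with polynomial entries in the state
    (Z : Fin N → MvPolynomial (Fin n) ℝ)
    (W : Matrix (Fin M) (Fin m) (MvPolynomial (Fin n) ℝ))
    -- true dynamics, disturbance bound, and the samples of the experiment
    (Astar : Matrix (Fin n) (Fin N) ℝ) (Bstar : Matrix (Fin n) (Fin M) ℝ)
    (Δ : Matrix (Fin n) (Fin r) ℝ)
    (x xdot d : Fin T → Fin n → ℝ) (u : Fin T → Fin m → ℝ)
    (hdata : ∀ i, xdot i = Matrix.mulVec Astar (DataDriven.evalVec Z (x i)) +
      Matrix.mulVec Bstar (Matrix.mulVec (DataDriven.evalMat W (x i)) (u i)) + d i)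
    (hdist : DataDriven.colMatrix d ∈ DataDriven.disturbanceSet T Δ)
    -- data matrices
    (X₁ : Matrix (Fin n) (Fin T) ℝ) (hX₁ : X₁ = DataDriven.colMatrix xdot)
    (Z₀ : Matrix (Fin N) (Fin T) ℝ)
    (hZ₀ : Z₀ = DataDriven.colMatrix fun i => DataDriven.evalVec Z (x i))
    (V₀ : Matrix (Fin M) (Fin T) ℝ)
    (hV₀ : V₀ = DataDriven.colMatrix fun i =>
      Matrix.mulVec (DataDriven.evalMat W (x i)) (u i))
    -- full row rank of the stacked data matrix
    (hrank : (Matrix.fromRows Z₀ V₀).rank = N + M)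
    -- design parameters
    (ℓ₀ ℓ₁ ℓ₂ : MvPolynomial (Fin n) ℝ)
    (hℓ₀ : DataDriven.PolyPosDef ℓ₀) (hℓ₁ : DataDriven.PolyPosDef ℓ₁)
    (hℓ₂ : DataDriven.PolyPosDef ℓ₂)
    (c : ℝ) (hc : 0 < c)
    -- decision variables
    (s₁ s₂ V lam : MvPolynomial (Fin n) ℝ) (k : Fin m → MvPolynomial (Fin n) ℝ)
    (hV0 : MvPolynomial.eval 0 V = 0) (hk0 : DataDriven.evalVec k 0 = 0)
    (hs : ∀ y : Fin n → ℝ, 0 ≤ MvPolynomial.eval y s₁ ∧ 0 ≤ MvPolynomial.eval y s₂)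
    (hVpos : ∀ y : Fin n → ℝ,
      0 ≤ MvPolynomial.eval y V - MvPolynomial.eval y ℓ₁ +
        MvPolynomial.eval y s₁ * (MvPolynomial.eval y ℓ₀ - c))
    (hdecr : ∀ y : Fin n → ℝ,
      (-DataDriven.decreaseMatrix (DataDriven.ellA Z₀ V₀) (DataDriven.ellQ X₁ Z₀ V₀ Δ)
        (MvPolynomial.eval y ℓ₂ +
          dotProduct (DataDriven.gradPoly V y)
            (Matrix.mulVec (DataDriven.ellCenter X₁ Z₀ V₀).transpose
              (DataDriven.regressor Z W k y)) -
          MvPolynomial.eval y s₂ * (MvPolynomial.eval y ℓ₀ - c))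
        (MvPolynomial.eval y lam)
        (DataDriven.regressor Z W k y)
        (DataDriven.gradPoly V y)).PosSemidef)
    (hlam : ∀ y : Fin n → ℝ, 0 < MvPolynomial.eval y lam) :
    (∀ AB ∈ DataDriven.consistentSet X₁ Z₀ V₀ Δ,
      DataDriven.IsLocallyAsymptoticallyStable (DataDriven.closedLoop Z W k AB.1 AB.2)) ∧
    DataDriven.IsLocallyAsymptoticallyStable (DataDriven.closedLoop Z W k Astar Bstar) := by
  subst hX₁ hZ₀ hV₀
  have hA := DataDriven.ellA_posDef hrank
  have hlas := fun AB hAB => DataDriven.isLocallyAsymptoticallyStable_closedLoop (k := k) hA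
    (AB := AB) hAB hℓ₀ hℓ₁ hℓ₂ hc hV0 hs hVpos hdecr hlam
  exact ⟨hlas, hlas (Astar, Bstar) (DataDriven.mem_consistentSet_of_data hdata hdist)⟩
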